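/- Let $M$ be a smooth (Hausdorff, second countable, finite-dimensional, boundaryless) manifold. For $k\in\mathbb Z$ let $A^k(M)=\Gamma(\wedge^kTM)$ be the space of smooth $k$-vector fields and $\Omega^k(M)$ the space of smooth $k$-forms (both $0$ for $k<0$; $A^0(M)=\Omega^0(M)=C^\infty(M)$), and let $\mathcal A(M)=\bigoplus_k A^k(M)$ with the Schouten--Nijenhuis bracket $[\cdot,\cdot]$. A $k$-form $\eta$ is evaluated on $k$-vector fields through the pairing $(\alpha^1\wedge\cdots\wedge\alpha^k)(v_1\wedge\cdots\wedge v_k)=\det(\alpha^i(v_j))$, with $\eta(f)=f\eta$ for $k=0$. A higher connection on $M$ is a map $\nabla:\mathcal A(M)\times\mathcal A(M)\to\mathcal A(M)$, $(X,Y)\mapsto\nabla_XY$, such that (i) $\nabla_XY\in A^{k+l-1}(M)$ for $X\in A^k(M)$, $Y\in A^l(M)$; (ii) $\nabla_{fX+X'}Y=f\nabla_XY+\nabla_{X'}Y$ for $f\in C^\infty(M)$ and $X,X',Y\in\mathcal A(M)$; (iii) $\nabla_X(Y+Y')=\nabla_XY+\nabla_XY'$ for $X,Y,Y'\in\mathcal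 A(M)$; (iv) $\nabla_Xf=[X,f]$ for $X\in A^k(M)$, $f\in C^\infty(M)$; (v) $\nabla_X(fY)=[X,f]\wedge Y+f\nabla_XY$ for $X\in A^k(M)$, $f\in C^\infty(M)$, $Y\in\mathcal A(M)$; (vi) $\nabla_fX=0$ for $f\in C^\infty(M)$, $X\in\mathcal A(M)$. For multivector fields $X$ and forms $\omega$ put $(i_X\omega)(Y):=\omega(X\wedge Y)$, and for $X\in A^k(M)$ put $L_X\omega:=d\,i_X\omega-(-1)^k\,i_Xd\omega$. Theorem. Let $\nabla$ be a higher connection on $M$, $X\in A^k(M)$ with $k>0$, and $\omega\in\Omega^l(M)$. For $Y\in A^{l-k+1}(M)$ put $$(\nabla_X\omega)(Y):=(-1)^{(k-1)(l-1)}L_Xi_Y\omega-\omega(\nabla_XY).$$ This expression is $C^\infty(M)$-linear in $Y$, that is, additive in $Y$ and satisfying $(\nabla_X\omega)(fY)=f\,(\nabla_X\omega)(Y)$ for $f\in C^\infty(M)$. Hence $\nabla_X\omega$ is a genuine differential form: there is exactly one $\eta\in\Omega^{l-k+1}(M)$ with $\eta(Y)=(\nabla_X\omega)(Y)$ for all $Y\in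 A^{l-k+1}(M)$. -/

import Mathlib

open scoped Manifold ContDiff

noncomputable section

namespace HigherConn

/-! ## Multilinear algebra -/

section Algebra

variable {V W : Type*} [AddCommGroup V] [Module ℝ V] [AddCommGroup W] [Module ℝ W]

/-- The homogeneous part `⋀ᵏ V` of the exterior algebra, for an integer `k`; it is `0` when
`k < 0`. -/
def gradedPart (V : Type*) [AddCommGroup V] [Module ℝ V] :
    ℤ → Submodule ℝ (ExteriorAlgebra ℝ V)
  | Int.ofNat n => ⋀[ℝ]^n V
  | Int.negSucc _ => ⊥

/-- The left contraction `α ⌋ x`: it is the antiderivation in `x` with `α ⌋ v = α v` for vectors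
`v`, so that `α ⌋ (v ∧ y) = α v • y - v ∧ (α ⌋ y)`. -/
def contractL (α : Module.Dual ℝ V) (x : ExteriorAlgebra ℝ V) : ExteriorAlgebra ℝ V :=
  CliffordAlgebra.contractLeft (Q := (0 : QuadraticForm ℝ V)) α x

/-- The right contraction `x ⌊ α`, with `(y ∧ v) ⌊ α = α v • y - (y ⌊ α) ∧ v` for vectors `v`; it
equals `(-1) ^ (k - 1) • (α ⌋ x)` on `⋀ᵏ V`. -/
def contractR (x : ExteriorAlgebra ℝ V) (α : Module.Dual ℝ V) : ExteriorAlgebra ℝ V :=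
  CliffordAlgebra.contractRight (Q := (0 : QuadraticForm ℝ V)) x α

/-- The alternating `j`-linear map `(v₁, …, vⱼ) ↦ a (v₁ ∧ ⋯ ∧ vⱼ)` given by a linear functional
`a` on the exterior algebra. -/
def altOfDual (a : Module.Dual ℝ (ExteriorAlgebra ℝ V)) (j : ℕ) : V [⋀^Fin j]→ₗ[ℝ] ℝ :=
  a.compAlternatingMap (ExteriorAlgebra.ιMulti ℝ j)

end Algebra

section Coordinates

variable {E : Type*} [NormedAddCommGroup E] [NormedSpace ℝ E] [FiniteDimensional ℝ E]

theorem continuous_alternating {j : ℕ} (a : E [⋀^Fin j]→ₗ[ℝ] ℝ) : Continuous a := by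
  let b := Module.finBasis ℝ E
  have h : (a : (Fin j → E) → ℝ) = fun v => ∑ r : Fin j → Fin (Module.finrank ℝ E),
      (∏ i, b.coord (r i) (v i)) • a (fun i => b (r i)) := by
    funext v
    have hv : v = fun i => ∑ s, b.coord s (v i) • b s := by
      funext i
      simp [b.sum_repr]
    conv_lhs => rw [hv]
    change a.toMultilinearMap _ = _
    rw [MultilinearMap.map_sum]
    refine Finset.sum_congr rfl fun r _ => ?_
    rw [MultilinearMap.map_smul_univ]
    rfl
  rw [h]
  refine continuous_finsetSum _ fun r _ => ?_
  refine Continuous.mul (continuous_finsetProd _ fun i _ => ?_) continuous_const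
  exact (LinearMap.continuous_of_finiteDimensional (b.coord (r i))).comp (continuous_apply i)

/-- An alternating form on a finite-dimensional normed space, as a continuous alternating form. -/
def toContAlt {j : ℕ} (a : E [⋀^Fin j]→ₗ[ℝ] ℝ) : E [⋀^Fin j]→L[ℝ] ℝ :=
  ⟨⟨a.toMultilinearMap, continuous_alternating a⟩, a.map_eq_zero_of_eq'⟩

/-- The derivative at `y`, in the direction `v`, of a function with values in the
finite-dimensional vector space `⋀ E`, taken coefficientwise in the basis `e_{i₁} ∧ ⋯ ∧ e_{iₖ}`
(`i₁ < ⋯ < iₖ`) of `⋀ E`. -/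
def extAlgDeriv (F : E → ExteriorAlgebra ℝ E) (y v : E) : ExteriorAlgebra ℝ E :=
  ∑ s : Finset (Fin (Module.finrank ℝ E)),
    fderiv ℝ (fun z => (Module.finBasis ℝ E).ExteriorAlgebra.coord s (F z)) y v •
      (Module.finBasis ℝ E).ExteriorAlgebra s

/-- The Schouten-Nijenhuis bracket of multivector fields on a vector space: with linear
coordinates `x¹, …, xⁿ`,
`[P, Q] = ∑ᵢ (P ⌊ dxⁱ) ∧ ∂ᵢ Q - ∑ᵢ ∂ᵢ P ∧ (dxⁱ ⌋ Q)`.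
It is the Lie bracket on vector fields, `[P, f] = P ⌊ df` for functions `f`, and
`[P, Q] = -(-1) ^ ((p - 1) * (q - 1)) [Q, P]`,
`[P, Q ∧ R] = [P, Q] ∧ R + (-1) ^ ((p - 1) * q) Q ∧ [P, R]`. -/
def schoutenE (P Q : E → ExteriorAlgebra ℝ E) (y : E) : ExteriorAlgebra ℝ E :=
  ∑ i : Fin (Module.finrank ℝ E),
    (contractR (P y) ((Module.finBasis ℝ E).coord i) *
        extAlgDeriv Q y (Module.finBasis ℝ E i)
      - extAlgDeriv P y (Module.finBasis ℝ E i) *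
        contractL ((Module.finBasis ℝ E).coord i) (Q y))

end Coordinates

/-! ## Multivector fields and differential forms on a manifold -/

section Manifold

variable (E : Type*) [NormedAddCommGroup E] [NormedSpace ℝ E]
variable (M : Type*) [TopologicalSpace M] [ChartedSpace E M] [IsManifold 𝓘(ℝ, E) ∞ M]

/-- The differential `dφ_p : T_pM → E` of the preferred chart `φ` around `x`, at a point `p` of its
domain: the trivialization of the tangent bundle by this chart. -/
def dChart (x p : M) : TangentSpace 𝓘(ℝ, E) p →ₗ[ℝ] E :=
  ((trivializationAt E (TangentSpace 𝓘(ℝ, E)) x).continuousLinearMapAt ℝ p).toLinearMap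

/-- The inverse `E → T_pM` of the differential `dφ_p` of the preferred chart `φ` around `x`, at a
point `p` of its domain, i.e. the differential at `φ p` of the inverse of `φ`. -/
def dChartSymm (x p : M) : E →ₗ[ℝ] TangentSpace 𝓘(ℝ, E) p :=
  ((trivializationAt E (TangentSpace 𝓘(ℝ, E)) x).symmL ℝ p).toLinearMap

/-- Arbitrary (not necessarily smooth) sections of the full exterior bundle `⋀ TM`. -/
abbrev RawMVF : Type _ := (p : M) → ExteriorAlgebra ℝ (TangentSpace 𝓘(ℝ, E) p)

/-- Arbitrary (not necessarily smooth) sections of the dual bundle of `⋀ TM`. -/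
abbrev RawForm : Type _ :=
  (p : M) → Module.Dual ℝ (ExteriorAlgebra ℝ (TangentSpace 𝓘(ℝ, E) p))

variable {E M}

/-- A section of `⋀ TM` read in the preferred chart `φ` around `x`, as an `⋀ E`-valued function
on (the image of the chart in) `E`. -/
def RawMVF.inChart (X : RawMVF E M) (x : M) (y : E) : ExteriorAlgebra ℝ E :=
  ExteriorAlgebra.map (dChart E M x ((extChartAt 𝓘(ℝ, E) x).symm y))
    (X ((extChartAt 𝓘(ℝ, E) x).symm y))

/-- A section of `⋀ TM` is smooth if all its components in all charts are smooth. -/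
def RawMVF.IsSmooth (X : RawMVF E M) : Prop :=
  ∀ (x : M) (a : Module.Dual ℝ (ExteriorAlgebra ℝ E)),
    ContMDiffOn 𝓘(ℝ, E) 𝓘(ℝ, ℝ) ∞
      (fun p => a (ExteriorAlgebra.map (dChart E M x p) (X p))) (chartAt E x).source

/-- A section of the dual of `⋀ TM` is smooth if its values on the constant-coefficient multivector
fields of every chart are smooth. -/
def RawForm.IsSmooth (α : RawForm E M) : Prop :=
  ∀ (x : M) (c : ExteriorAlgebra ℝ E),
    ContMDiffOn 𝓘(ℝ, E) 𝓘(ℝ, ℝ) ∞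
      (fun p => α p (ExteriorAlgebra.map (dChartSymm E M x p) c)) (chartAt E x).source

variable (E M)

/-- The space `𝒜(M) = Γ(⋀ TM) = ⨁ₖ Aᵏ(M)` of smooth multivector fields on `M`. -/
def MVF : Submodule ℝ (RawMVF E M) where
  carrier := {X | X.IsSmooth}
  zero_mem' := fun x a => by simpa using contMDiffOn_const
  add_mem' := fun {X Y} hX hY x a => by
    simp only [Pi.add_apply, map_add]
    exact (hX x a).add (hY x a)
  smul_mem' := fun c X hX x a => by
    simp only [Pi.smul_apply, map_smul, smul_eq_mul]
    exact contMDiffOn_const.mul (hX x a)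

/-- The space `Ω(M) = ⨁ₗ Ωˡ(M)` of smooth differential forms on `M`: smooth sections of the dual
of `⋀ TM`, where `⋀ˡ T*_pM` is identified with the dual of `⋀ˡ T_pM` through the pairing
`⟨β₁ ∧ ⋯ ∧ βₗ, v₁ ∧ ⋯ ∧ vₗ⟩ = det (βᵢ vⱼ)`. -/
def DForm : Submodule ℝ (RawForm E M) where
  carrier := {α | α.IsSmooth}
  zero_mem' := fun x c => contMDiffOn_const
  add_mem' := fun {α η} hα hη x c => by
    simp only [Pi.add_apply, LinearMap.add_apply]
    exact (hα x c).add (hη x c)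
  smul_mem' := fun r α hα x c => by
    simp only [Pi.smul_apply, LinearMap.smul_apply, smul_eq_mul]
    exact contMDiffOn_const.mul (hα x c)

/-- The space `Aᵏ(M) = Γ(⋀ᵏ TM)` of `k`-vector fields; it is `0` for `k < 0`. -/
def MVF.ofDegree (k : ℤ) : Submodule ℝ (MVF E M) where
  carrier := {X | ∀ p, X.1 p ∈ gradedPart (TangentSpace 𝓘(ℝ, E) p) k}
  zero_mem' := fun _ => (gradedPart _ k).zero_mem
  add_mem' := fun hX hY p => (gradedPart _ k).add_mem (hX p) (hY p)
  smul_mem' := fun c _ hX p => (gradedPart _ k).smul_mem c (hX p)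

/-- The space `Ωˡ(M)` of differential `l`-forms, i.e. of the forms which vanish on `⋀ʲ T_pM` for
all `j ≠ l`; it is `0` for `l < 0`. -/
def DForm.ofDegree (l : ℤ) : Submodule ℝ (DForm E M) where
  carrier := {α | ∀ (j : ℤ), j ≠ l → ∀ p, ∀ v ∈ gradedPart (TangentSpace 𝓘(ℝ, E) p) j,
    α.1 p v = 0}
  zero_mem' := fun _ _ _ _ _ => rfl
  add_mem' := fun {α η} hα hη j hj p v hv => by
    simp [hα j hj p v hv, hη j hj p v hv]
  smul_mem' := fun c α hα j hj p v hv => by simp [hα j hj p v hv]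

variable {E M}

/-- A smooth function, as a `0`-vector field. -/
def funMVF (f : C^∞⟮𝓘(ℝ, E), M; ℝ⟯) : MVF E M :=
  ⟨fun p => algebraMap ℝ _ (f p), fun x a => by
    have h : ∀ p : M, a (ExteriorAlgebra.map (dChart E M x p) (algebraMap ℝ _ (f p)))
        = f p * a 1 := by
      intro p
      rw [AlgHom.commutes, Algebra.algebraMap_eq_smul_one, map_smul, smul_eq_mul]
    simp only [h]
    exact f.contMDiff.contMDiffOn.mul contMDiffOn_const⟩

/-- Pointwise multiplication of multivector fields by smooth functions. -/
instance : Module C^∞⟮𝓘(ℝ, E), M; ℝ⟯ (MVF E M) where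
  smul f X := ⟨fun p => f p • X.1 p, fun x a => by
    simp only [map_smul, smul_eq_mul]
    exact f.contMDiff.contMDiffOn.mul (X.2 x a)⟩
  one_smul X := Subtype.ext (funext fun p => one_smul ℝ (X.1 p))
  mul_smul f g X := Subtype.ext (funext fun p => mul_smul (f p) (g p) (X.1 p))
  smul_zero f := Subtype.ext (funext fun p => smul_zero (f p))
  smul_add f X Y := Subtype.ext (funext fun p => smul_add (f p) (X.1 p) (Y.1 p))
  add_smul f g X := Subtype.ext (funext fun p => add_smul (f p) (g p) (X.1 p))
  zero_smul X := Subtype.ext (funext fun p => zero_smul ℝ (X.1 p))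

/-- The interior product `(i_X α)(Y) = α (X ∧ Y)`. -/
def interior (X : RawMVF E M) (α : RawForm E M) : RawForm E M :=
  fun p => (α p).comp (LinearMap.mulLeft ℝ (X p))

section FiniteDim

variable [FiniteDimensional ℝ E]

/-- The Schouten-Nijenhuis bracket of smooth multivector fields on a manifold: its value at `p` is
computed in the preferred chart around `p` (any other chart gives the same value). -/
def schouten (P Q : RawMVF E M) (p : M) : ExteriorAlgebra ℝ (TangentSpace 𝓘(ℝ, E) p) :=
  ExteriorAlgebra.map (dChartSymm E M p p)
    (schoutenE (P.inChart p) (Q.inChart p) (extChartAt 𝓘(ℝ, E) p p))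

/-- The degree `j` part of a form, pulled back to (the image in) `E` of the preferred chart
around `x`. -/
def RawForm.inChart (α : RawForm E M) (x : M) (j : ℕ) (y : E) : E [⋀^Fin j]→L[ℝ] ℝ :=
  toContAlt ((altOfDual (α ((extChartAt 𝓘(ℝ, E) x).symm y)) j).compLinearMap
    (dChartSymm E M x ((extChartAt 𝓘(ℝ, E) x).symm y)))

/-- The exterior derivative: its value at `p` is computed in the preferred chart `φ` around `p`,
as `φ^* d((φ⁻¹)^* α)` (any other chart gives the same value). -/
def extD (α : RawForm E M) : RawForm E M := fun p =>
  ExteriorAlgebra.liftAlternating fun j =>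
    match j with
    | 0 => 0
    | j + 1 =>
      (extDeriv (α.inChart p j) (extChartAt 𝓘(ℝ, E) p p)).toAlternatingMap.compLinearMap
        (dChart E M p p)

/-- The Lie derivative `L_X α = d i_X α - (-1) ^ k i_X d α` of a form along a `k`-vector field. -/
def lieD (k : ℤ) (X : RawMVF E M) (α : RawForm E M) : RawForm E M :=
  extD (interior X α) - (-1 : ℝ) ^ k • interior X (extD α)

variable (E M)

/-- A higher (affine) connection on `M`. -/
structure HigherConnection where
  /-- The map `(X, Y) ↦ ∇_X Y`. -/
  nabla : MVF E M → MVF E M → MVF E M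
  mem_ofDegree : ∀ {k l : ℤ} {X Y : MVF E M}, X ∈ MVF.ofDegree E M k → Y ∈ MVF.ofDegree E M l →
    nabla X Y ∈ MVF.ofDegree E M (k + l - 1)
  smul_add_left : ∀ (f : C^∞⟮𝓘(ℝ, E), M; ℝ⟯) (X X' Y : MVF E M),
    nabla (f • X + X') Y = f • nabla X Y + nabla X' Y
  add_right : ∀ X Y Y' : MVF E M, nabla X (Y + Y') = nabla X Y + nabla X Y'
  apply_fun : ∀ {k : ℤ} {X : MVF E M}, X ∈ MVF.ofDegree E M k →
    ∀ (f : C^∞⟮𝓘(ℝ, E), M; ℝ⟯) (p : M),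
      (nabla X (funMVF f)).1 p = schouten X.1 (funMVF f).1 p
  leibniz : ∀ {k : ℤ} {X : MVF E M}, X ∈ MVF.ofDegree E M k →
    ∀ (f : C^∞⟮𝓘(ℝ, E), M; ℝ⟯) (Y : MVF E M) (p : M),
      (nabla X (f • Y)).1 p = schouten X.1 (funMVF f).1 p * Y.1 p + f p • (nabla X Y).1 p
  along_fun : ∀ (f : C^∞⟮𝓘(ℝ, E), M; ℝ⟯) (X : MVF E M), nabla (funMVF f) X = 0

variable {E M}

/-- The expression `(∇_X α)(Y) = (-1) ^ ((k - 1) * (l - 1)) L_X i_Y α - α(∇_X Y)`, for a `k`-vector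
field `X`, an `l`-form `α` and an `(l - k + 1)`-vector field `Y`. Here `L_X i_Y α` is a `0`-form;
the function that it is equal to is its value on `1 ∈ ⋀⁰ T_pM = ℝ`. -/
def HigherConnection.covForm (C : HigherConnection E M) (k l : ℤ) (X : MVF E M) (α : DForm E M)
    (Y : MVF E M) : M → ℝ := fun p =>
  (-1 : ℝ) ^ ((k - 1) * (l - 1)) * lieD k X.1 (interior Y.1 α.1) p 1 - α.1 p ((C.nabla X Y).1 p)

end FiniteDim

end Manifold

end HigherConn

end

/-!
Let `k` and `l` be the degrees of `X` and `α`, and let `Y` have degree `l - k + 1`. On the `0`-form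
`i_Y α` the Lie derivative `L_X` reduces to `-(-1) ^ k i_X d`, so that, up to a sign depending on
the degrees only, the first term of `(∇_X α)(Y)` is `d(i_Y α)(X)`. Replacing `Y` by `f Y` then adds
`(df ∧ i_Y α)(X) = α(Y ∧ (df ⌋ X))` to it, while the Leibniz rule for `∇_X` adds `α([X, f] ∧ Y)`,
where `[X, f] = X ⌊ df`, to `α(∇_X (f Y))`. These two terms cancel by graded commutativity of the
wedge product.

A `C^∞(M)`-linear map on multivector fields is evaluation of a form: multiplying by a bump function
and expanding in the frame of a chart shows that its value at `p` depends only on `Y p`.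
-/

namespace HigherConn

section ExteriorAlgebra

open CliffordAlgebra (contractLeft contractRight involute)
open ExteriorAlgebra (ι ιMulti)

variable {R V W : Type*} [CommRing R] [AddCommGroup V] [Module R V] [AddCommGroup W] [Module R W]

theorem contractLeft_mul_ι {Q : QuadraticForm R V} (d : Module.Dual R V) (x : CliffordAlgebra Q)
    (v : V) : contractLeft d (x * CliffordAlgebra.ι Q v) =
      contractLeft d x * CliffordAlgebra.ι Q v + d v • involute x := by
  induction x using CliffordAlgebra.left_induction with
  | algebraMap r =>
    simp [CliffordAlgebra.contractLeft_ι, Algebra.algebraMap_eq_smul_one, smul_comm r]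
  | add x y hx hy =>
    simp only [add_mul, map_add, hx, hy, smul_add]
    abel
  | ι_mul x w hx =>
    simp only [mul_assoc, CliffordAlgebra.contractLeft_ι_mul, hx, mul_add, map_mul,
      CliffordAlgebra.involute_ι, sub_mul, smul_mul_assoc, mul_smul_comm, neg_mul, smul_neg]
    abel

theorem contractRight_eq_involute_contractLeft {Q : QuadraticForm R V} (x : CliffordAlgebra Q)
    (d : Module.Dual R V) : contractRight x d = involute (contractLeft d x) := by
  induction x using CliffordAlgebra.right_induction with
  | algebraMap r =>
    rw [CliffordAlgebra.contractRight_algebraMap, CliffordAlgebra.contractLeft_algebraMap, map_zero]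
  | add x y hx hy => simp only [map_add, LinearMap.add_apply, hx, hy]
  | mul_ι v x hx =>
    rw [CliffordAlgebra.contractRight_mul_ι, contractLeft_mul_ι, hx, map_add, map_mul, map_smul,
      CliffordAlgebra.involute_ι, CliffordAlgebra.involute_involute, mul_neg, sub_eq_neg_add]

theorem contractLeft_map (f : V →ₗ[R] W) (d : Module.Dual R W) (x : ExteriorAlgebra R V) :
    contractLeft d (ExteriorAlgebra.map f x) =
      ExteriorAlgebra.map f (contractLeft (d ∘ₗ f) x) := by
  induction x using CliffordAlgebra.left_induction with
  | algebraMap r => simp [CliffordAlgebra.contractLeft_algebraMap]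
  | add x y hx hy => simp only [map_add, hx, hy]
  | ι_mul x v hx =>
    rw [map_mul, ExteriorAlgebra.map_apply_ι, CliffordAlgebra.contractLeft_ι_mul,
      CliffordAlgebra.contractLeft_ι_mul, hx, map_sub, map_smul, map_mul,
      ExteriorAlgebra.map_apply_ι, LinearMap.comp_apply]

theorem involute_map (f : V →ₗ[R] W) (x : ExteriorAlgebra R V) :
    involute (ExteriorAlgebra.map f x) = ExteriorAlgebra.map f (involute x) := by
  induction x using CliffordAlgebra.left_induction with
  | algebraMap r => simp only [AlgHom.commutes]
  | add x y hx hy => simp only [map_add, hx, hy]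
  | ι_mul x v hx =>
    rw [map_mul, map_mul, map_mul, map_mul, hx, ExteriorAlgebra.map_apply_ι,
      CliffordAlgebra.involute_ι, CliffordAlgebra.involute_ι, map_neg, ExteriorAlgebra.map_apply_ι]

theorem contractRight_map (f : V →ₗ[R] W) (x : ExteriorAlgebra R V) (d : Module.Dual R W) :
    contractRight (ExteriorAlgebra.map f x) d =
      ExteriorAlgebra.map f (contractRight x (d ∘ₗ f)) := by
  rw [contractRight_eq_involute_contractLeft, contractRight_eq_involute_contractLeft,
    contractLeft_map, involute_map]

theorem ι_mul_eq_involute_mul_ι (v : V) (x : ExteriorAlgebra R V) :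
    ι R v * x = involute x * ι R v := by
  induction x using CliffordAlgebra.left_induction with
  | algebraMap r => rw [AlgHom.commutes, Algebra.commutes]
  | add x y hx hy => rw [mul_add, map_add, add_mul, hx, hy]
  | ι_mul x w hx =>
    rw [map_mul, CliffordAlgebra.involute_ι, ← mul_assoc,
      eq_neg_of_add_eq_zero_left (ExteriorAlgebra.ι_add_mul_swap v w), neg_mul, mul_assoc, hx,
      neg_mul, neg_mul, mul_assoc]

theorem involute_of_mem_exteriorPower {n : ℕ} {x : ExteriorAlgebra R V} (hx : x ∈ ⋀[R]^n V) :
    involute x = (-1 : R) ^ n • x := by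
  induction hx using Submodule.pow_induction_on_left' with
  | algebraMap r => simp
  | add x y i _ _ hx hy => rw [map_add, hx, hy, smul_add]
  | mem_mul v hv i x _ hx =>
    obtain ⟨v, rfl⟩ := hv
    rw [map_mul, CliffordAlgebra.involute_ι, hx, neg_mul, mul_smul_comm, pow_succ,
      mul_neg_one, neg_smul]

theorem mul_comm_of_mem_exteriorPower {m n : ℕ} {x y : ExteriorAlgebra R V}
    (hx : x ∈ ⋀[R]^m V) (hy : y ∈ ⋀[R]^n V) : x * y = (-1 : R) ^ (m * n) • (y * x) := by
  induction hx using Submodule.pow_induction_on_left' with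
  | algebraMap r => simp [Algebra.commutes]
  | add x x' i _ _ hx hx' => rw [add_mul, mul_add, smul_add, hx, hx']
  | mem_mul v hv i x _ hx =>
    obtain ⟨v, rfl⟩ := hv
    rw [mul_assoc, hx, mul_smul_comm, ← mul_assoc, ι_mul_eq_involute_mul_ι,
      involute_of_mem_exteriorPower hy, smul_mul_assoc, smul_mul_assoc, smul_smul, mul_assoc,
      ← pow_add, Nat.succ_mul]

theorem map_mem_exteriorPower (f : V →ₗ[R] W) {n : ℕ} {x : ExteriorAlgebra R V}
    (hx : x ∈ ⋀[R]^n V) : ExteriorAlgebra.map f x ∈ ⋀[R]^n W := by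
  have h := Submodule.mem_map_of_mem (f := (ExteriorAlgebra.map f).toLinearMap) hx
  rw [Submodule.map_pow, ExteriorAlgebra.ι_range_map_map] at h
  exact pow_le_pow_left' LinearMap.map_le_range n h

theorem contractLeft_ιMulti (d : Module.Dual R V) {n : ℕ} (v : Fin (n + 1) → V) :
    contractLeft d (ιMulti R (n + 1) v) =
      ∑ i : Fin (n + 1), ((-1 : R) ^ (i : ℕ) * d (v i)) • ιMulti R n (i.removeNth v) := by
  induction n with
  | zero =>
    simp [ExteriorAlgebra.ιMulti_succ_apply, Algebra.algebraMap_eq_smul_one]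
  | succ n ih =>
    rw [ExteriorAlgebra.ιMulti_succ_apply, CliffordAlgebra.contractLeft_ι_mul, ih, sub_eq_add_neg,
      Fin.sum_univ_succ (n := n + 1), Finset.mul_sum, ← Finset.sum_neg_distrib]
    congr 1
    · simp [Fin.removeNth_zero, Matrix.vecTail, Fin.tail_def, Function.comp_def]
    · refine Finset.sum_congr rfl fun i _ => ?_
      rw [mul_smul_comm, ExteriorAlgebra.ιMulti_succ_apply (v := i.succ.removeNth v), ← neg_smul]
      congr 1
      · simp [Matrix.vecTail, pow_succ]
      · congr 2
        ext j
        simp [Fin.removeNth, Matrix.vecTail]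

theorem contractLeft_mem_exteriorPower (d : Module.Dual R V) {n : ℕ} {x : ExteriorAlgebra R V}
    (hx : x ∈ ⋀[R]^(n + 1) V) : contractLeft d x ∈ ⋀[R]^n V := by
  rw [← ExteriorAlgebra.ιMulti_span_fixedDegree] at hx
  induction hx using Submodule.span_induction with
  | mem x hx =>
    obtain ⟨v, rfl⟩ := hx
    rw [contractLeft_ιMulti]
    exact sum_mem fun i _ => Submodule.smul_mem _ _ (ExteriorAlgebra.ιMulti_range R n ⟨_, rfl⟩)
  | zero => simp
  | add x y _ _ hx hy => simpa using add_mem hx hy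
  | smul r x _ hx => simpa using Submodule.smul_mem _ r hx

end ExteriorAlgebra

section GradedPart

variable {V W : Type*} [AddCommGroup V] [Module ℝ V] [AddCommGroup W] [Module ℝ W]

theorem map_mem_gradedPart (f : V →ₗ[ℝ] W) {k : ℤ} {x : ExteriorAlgebra ℝ V}
    (hx : x ∈ gradedPart V k) : ExteriorAlgebra.map f x ∈ gradedPart W k := by
  cases k with
  | ofNat n => exact map_mem_exteriorPower f hx
  | negSucc n =>
    rw [(Submodule.mem_bot ℝ).1 hx, map_zero]
    exact zero_mem _

theorem involute_of_mem_gradedPart {k : ℤ} {x : ExteriorAlgebra ℝ V} (hx : x ∈ gradedPart V k) :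
    CliffordAlgebra.involute x = (-1 : ℝ) ^ k • x := by
  cases k with
  | ofNat n => exact involute_of_mem_exteriorPower hx
  | negSucc n => rw [(Submodule.mem_bot ℝ).1 hx, map_zero, smul_zero]

theorem mul_comm_of_mem_gradedPart {k l : ℤ} {x y : ExteriorAlgebra ℝ V}
    (hx : x ∈ gradedPart V k) (hy : y ∈ gradedPart V l) : x * y = (-1 : ℝ) ^ (k * l) • (y * x) := by
  cases k with
  | ofNat m =>
    cases l with
    | ofNat n =>
      rw [Int.ofNat_eq_natCast, Int.ofNat_eq_natCast, ← Nat.cast_mul, zpow_natCast]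
      exact mul_comm_of_mem_exteriorPower hx hy
    | negSucc n => rw [(Submodule.mem_bot ℝ).1 hy, mul_zero, zero_mul, smul_zero]
  | negSucc m => rw [(Submodule.mem_bot ℝ).1 hx, mul_zero, zero_mul, smul_zero]

theorem contractL_mem_gradedPart (d : Module.Dual ℝ V) {k : ℤ} {x : ExteriorAlgebra ℝ V}
    (hx : x ∈ gradedPart V k) : contractL d x ∈ gradedPart V (k - 1) := by
  match k with
  | Int.ofNat 0 =>
    obtain ⟨r, rfl⟩ := Submodule.mem_one.1 (show x ∈ (1 : Submodule ℝ _) from hx)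
    rw [contractL, CliffordAlgebra.contractLeft_algebraMap]
    exact zero_mem _
  | Int.ofNat (n + 1) =>
    rw [Int.ofNat_eq_natCast, Nat.cast_succ, add_sub_cancel_right]
    exact contractLeft_mem_exteriorPower d hx
  | Int.negSucc n =>
    rw [(Submodule.mem_bot ℝ).1 hx, contractL, map_zero]
    exact zero_mem _

theorem contractR_of_mem_gradedPart (d : Module.Dual ℝ V) {k : ℤ} {x : ExteriorAlgebra ℝ V}
    (hx : x ∈ gradedPart V k) : contractR x d = (-1 : ℝ) ^ (k - 1) • contractL d x := by
  rw [contractR, contractRight_eq_involute_contractLeft]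
  exact involute_of_mem_gradedPart (contractL_mem_gradedPart d hx)

/-- The projection of `⋀ V` onto its homogeneous part of degree `k`, for an integer `k`. -/
noncomputable def gradedProj (V : Type*) [AddCommGroup V] [Module ℝ V] :
    ℤ → ExteriorAlgebra ℝ V →ₗ[ℝ] ExteriorAlgebra ℝ V
  | Int.ofNat n => GradedAlgebra.proj (fun i : ℕ => ⋀[ℝ]^i V) n
  | Int.negSucc _ => 0

theorem gradedProj_mem (k : ℤ) (x : ExteriorAlgebra ℝ V) : gradedProj V k x ∈ gradedPart V k := by
  cases k with
  | ofNat n => exact (DirectSum.decompose (fun i : ℕ => ⋀[ℝ]^i V) x n).2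
  | negSucc n => exact zero_mem _

theorem gradedProj_of_mem {k : ℤ} {x : ExteriorAlgebra ℝ V} (hx : x ∈ gradedPart V k) :
    gradedProj V k x = x := by
  cases k with
  | ofNat n => exact DirectSum.decompose_of_mem_same (fun i : ℕ => ⋀[ℝ]^i V) hx
  | negSucc n => exact ((Submodule.mem_bot ℝ).1 hx).symm

theorem gradedProj_of_mem_ne {j k : ℤ} {x : ExteriorAlgebra ℝ V} (hx : x ∈ gradedPart V j)
    (h : j ≠ k) : gradedProj V k x = 0 := by
  cases k with
  | ofNat n =>
    cases j with
    | ofNat m => exact DirectSum.decompose_of_mem_ne (fun i : ℕ => ⋀[ℝ]^i V) hx (by simpa using h)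
    | negSucc m => rw [(Submodule.mem_bot ℝ).1 hx, map_zero]
  | negSucc n => rfl

theorem linearMap_ext_of_gradedPart {f g : ExteriorAlgebra ℝ V →ₗ[ℝ] W}
    (h : ∀ k, ∀ x ∈ gradedPart V k, f x = g x) : f = g := by
  refine ExteriorAlgebra.lhom_ext fun n => AlternatingMap.ext fun v => ?_
  exact h n _ (ExteriorAlgebra.ιMulti_range ℝ n ⟨v, rfl⟩)

theorem map_gradedProj (f : V →ₗ[ℝ] W) (k : ℤ) (x : ExteriorAlgebra ℝ V) :
    ExteriorAlgebra.map f (gradedProj V k x) = gradedProj W k (ExteriorAlgebra.map f x) := by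
  suffices h : (ExteriorAlgebra.map f).toLinearMap ∘ₗ gradedProj V k =
      gradedProj W k ∘ₗ (ExteriorAlgebra.map f).toLinearMap from LinearMap.congr_fun h x
  refine linearMap_ext_of_gradedPart fun j y hy => ?_
  simp only [LinearMap.comp_apply, AlgHom.toLinearMap_apply]
  obtain rfl | hjk := eq_or_ne j k
  · rw [gradedProj_of_mem hy, gradedProj_of_mem (map_mem_gradedPart f hy)]
  · rw [gradedProj_of_mem_ne hy hjk, gradedProj_of_mem_ne (map_mem_gradedPart f hy) hjk, map_zero]

theorem sum_altOfDual_removeNth (a : Module.Dual ℝ (ExteriorAlgebra ℝ V)) (d : Module.Dual ℝ V)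
    {n : ℕ} (v : Fin (n + 1) → V) :
    ∑ i : Fin (n + 1), (-1 : ℝ) ^ (i : ℕ) * (d (v i) * altOfDual a n (i.removeNth v)) =
      a (contractL d (ExteriorAlgebra.ιMulti ℝ (n + 1) v)) := by
  rw [contractL, contractLeft_ιMulti, map_sum]
  refine Finset.sum_congr rfl fun i _ => ?_
  rw [map_smul, smul_eq_mul, mul_assoc]
  rfl

end GradedPart

section ContMDiff

variable {E F H N : Type*} [NormedAddCommGroup E] [NormedSpace ℝ E] [TopologicalSpace H]
  {I : ModelWithCorners ℝ E H} [TopologicalSpace N] [ChartedSpace H N]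
  {G : Type*} [NormedAddCommGroup G] [NormedSpace ℝ G]
  [NormedAddCommGroup F] [NormedSpace ℝ F] [FiniteDimensional ℝ F]

theorem contMDiffOn_exteriorAlgebra_map {n : ℕ∞ω} {L : N → G →L[ℝ] F} {s : Set N}
    (hL : ContMDiffOn I 𝓘(ℝ, G →L[ℝ] F) n L s) (a : Module.Dual ℝ (ExteriorAlgebra ℝ F))
    (c : ExteriorAlgebra ℝ G) :
    ContMDiffOn I 𝓘(ℝ, ℝ) n (fun q => a (ExteriorAlgebra.map (L q).toLinearMap c)) s := by
  induction c using CliffordAlgebra.left_induction generalizing a with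
  | algebraMap r => simpa only [AlgHom.commutes] using contMDiffOn_const
  | add c d hc hd =>
    simp only [map_add]
    exact (hc a).add (hd a)
  | ι_mul c v hc =>
    let b := Module.finBasis ℝ F
    have hexp (q : N) : a (ExteriorAlgebra.map (L q).toLinearMap (ExteriorAlgebra.ι ℝ v * c)) =
        ∑ i, b.coord i (L q v) * (a ∘ₗ LinearMap.mulLeft ℝ (ExteriorAlgebra.ι ℝ (b i)))
          (ExteriorAlgebra.map (L q).toLinearMap c) := by
      conv_lhs => rw [map_mul, ExteriorAlgebra.map_apply_ι, ContinuousLinearMap.coe_coe,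
        ← b.sum_repr (L q v)]
      simp only [map_sum, map_smul, Finset.sum_mul, smul_mul_assoc, smul_eq_mul,
        LinearMap.comp_apply, LinearMap.mulLeft_apply, Module.Basis.coord_apply]
    have hcoord (i) : ContMDiffOn I 𝓘(ℝ, ℝ) n (fun q => b.coord i (L q v)) s :=
      (b.coord i).toContinuousLinearMap.contMDiff.comp_contMDiffOn (hL.clm_apply contMDiffOn_const)
    exact (contMDiffOn_finsetSum fun i _ => (hcoord i).mul (hc _)).congr fun q _ => hexp q

end ContMDiff

section Charts

open Filter Topology

variable {E : Type*} [NormedAddCommGroup E] [NormedSpace ℝ E]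
  {M : Type*} [TopologicalSpace M] [ChartedSpace E M]

theorem extChartAt_symm_extChartAt {x q : M} (hq : q ∈ (chartAt E x).source) :
    (extChartAt 𝓘(ℝ, E) x).symm (extChartAt 𝓘(ℝ, E) x q) = q :=
  (extChartAt 𝓘(ℝ, E) x).left_inv (by simpa using hq)

theorem extChartAt_target_mem_nhds_of_mem_source {x q : M} (hq : q ∈ (chartAt E x).source) :
    (extChartAt 𝓘(ℝ, E) x).target ∈ 𝓝 (extChartAt 𝓘(ℝ, E) x q) :=
  (isOpen_extChartAt_target x).mem_nhds ((extChartAt 𝓘(ℝ, E) x).map_source (by simpa using hq))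

theorem eventually_nhds_extChartAt {x q : M} (hq : q ∈ (chartAt E x).source) {P : E → Prop}
    (h : ∀ᶠ p in 𝓝 q, P (extChartAt 𝓘(ℝ, E) x p)) : ∀ᶠ y in 𝓝 (extChartAt 𝓘(ℝ, E) x q), P y := by
  have htend := (continuousAt_extChartAt_symm' (I := 𝓘(ℝ, E)) (x := x) (by simpa using hq)).tendsto
  rw [extChartAt_symm_extChartAt hq] at htend
  filter_upwards [htend.eventually h, extChartAt_target_mem_nhds_of_mem_source hq] with y hy hyt
  rwa [(extChartAt 𝓘(ℝ, E) x).right_inv hyt] at hy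

variable [IsManifold 𝓘(ℝ, E) ∞ M]

theorem dChartSymm_dChart {x q : M} (hq : q ∈ (chartAt E x).source)
    (v : TangentSpace 𝓘(ℝ, E) q) : dChartSymm E M x q (dChart E M x q v) = v :=
  (trivializationAt E (TangentSpace 𝓘(ℝ, E)) x).symmL_continuousLinearMapAt (R := ℝ)
    (by simpa using hq) v

theorem dChart_eq_tangentCoordChange {x q : M} (hq : q ∈ (chartAt E x).source) :
    dChart E M x q = (tangentCoordChange 𝓘(ℝ, E) q x q).toLinearMap := by
  rw [dChart, TangentBundle.continuousLinearMapAt_trivializationAt_eq_core hq]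

theorem dChart_self (q : M) : dChart E M q q = LinearMap.id := by
  rw [dChart_eq_tangentCoordChange (mem_chart_source E q)]
  exact LinearMap.ext fun v => tangentCoordChange_self (by simp)

theorem dChart_dChartSymm {x x' q : M} (hq : q ∈ (chartAt E x).source)
    (hq' : q ∈ (chartAt E x').source) (v : E) :
    dChart E M x' q (dChartSymm E M x q v) = tangentCoordChange 𝓘(ℝ, E) x x' q v := by
  rw [dChart_eq_tangentCoordChange hq', dChartSymm,
    TangentBundle.symmL_trivializationAt_eq_core hq]
  exact tangentCoordChange_comp (by simp [hq, hq'])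

theorem map_dChartSymm_map_dChart {x q : M} (hq : q ∈ (chartAt E x).source)
    (z : ExteriorAlgebra ℝ (TangentSpace 𝓘(ℝ, E) q)) :
    ExteriorAlgebra.map (dChartSymm E M x q) (ExteriorAlgebra.map (dChart E M x q) z) = z := by
  have h : dChartSymm E M x q ∘ₗ dChart E M x q = LinearMap.id :=
    LinearMap.ext (dChartSymm_dChart hq)
  rw [← AlgHom.comp_apply, ExteriorAlgebra.map_comp_map, h, ExteriorAlgebra.map_id, AlgHom.id_apply]

theorem map_dChart_map_dChartSymm {x x' q : M} (hq : q ∈ (chartAt E x).source)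
    (hq' : q ∈ (chartAt E x').source) (c : ExteriorAlgebra ℝ E) :
    ExteriorAlgebra.map (dChart E M x' q) (ExteriorAlgebra.map (dChartSymm E M x q) c) =
      ExteriorAlgebra.map (tangentCoordChange 𝓘(ℝ, E) x x' q).toLinearMap c := by
  have h : dChart E M x' q ∘ₗ dChartSymm E M x q =
      (tangentCoordChange 𝓘(ℝ, E) x x' q).toLinearMap :=
    LinearMap.ext (dChart_dChartSymm hq hq')
  rw [← AlgHom.comp_apply, ExteriorAlgebra.map_comp_map, h]

theorem contMDiffOn_tangentCoordChange (x x' : M) :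
    ContMDiffOn 𝓘(ℝ, E) 𝓘(ℝ, E →L[ℝ] E) ∞ (tangentCoordChange 𝓘(ℝ, E) x x')
      ((chartAt E x).source ∩ (chartAt E x').source) :=
  haveI : IsManifold 𝓘(ℝ, E) (∞ + 1) M := ‹IsManifold 𝓘(ℝ, E) ∞ M›
  haveI := tangentBundleCore.isContMDiff (I := 𝓘(ℝ, E)) (M := M) (n := ∞)
  (tangentBundleCore 𝓘(ℝ, E) M).contMDiffOn_coordChange 𝓘(ℝ, E) (achart E x) (achart E x')

theorem hasFDerivAt_transition {x x' q : M} (hq : q ∈ (chartAt E x).source)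
    (hq' : q ∈ (chartAt E x').source) :
    HasFDerivAt (extChartAt 𝓘(ℝ, E) x' ∘ (extChartAt 𝓘(ℝ, E) x).symm)
      (tangentCoordChange 𝓘(ℝ, E) x x' q) (extChartAt 𝓘(ℝ, E) x q) := by
  rw [← hasFDerivWithinAt_univ]
  simpa using hasFDerivWithinAt_tangentCoordChange (I := 𝓘(ℝ, E)) (x := x) (y := x') (z := q)
    (by simp [hq, hq'])

theorem contDiffAt_transition {x x' q : M} (hq : q ∈ (chartAt E x).source)
    (hq' : q ∈ (chartAt E x').source) :
    ContDiffAt ℝ ∞ (extChartAt 𝓘(ℝ, E) x' ∘ (extChartAt 𝓘(ℝ, E) x).symm)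
      (extChartAt 𝓘(ℝ, E) x q) := by
  have h := contDiffWithinAt_ext_coord_change (I := 𝓘(ℝ, E)) (n := ∞) x' x
    (y := extChartAt 𝓘(ℝ, E) x q) (by simp [hq, hq'])
  simpa [contDiffWithinAt_univ] using h

/-- The differential `df_p`, as a linear functional on `T_pM`. -/
noncomputable def differential (f : C^∞⟮𝓘(ℝ, E), M; ℝ⟯) (p : M) :
    Module.Dual ℝ (TangentSpace 𝓘(ℝ, E) p) :=
  (mfderiv 𝓘(ℝ, E) 𝓘(ℝ, ℝ) f p).toLinearMap

theorem differential_eq_fderiv_comp_dChart (f : C^∞⟮𝓘(ℝ, E), M; ℝ⟯) (p : M) :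
    differential f p = (fderiv ℝ (f ∘ (extChartAt 𝓘(ℝ, E) p).symm)
      (extChartAt 𝓘(ℝ, E) p p)).toLinearMap ∘ₗ dChart E M p p := by
  rw [dChart_self, differential, (f.contMDiff.mdifferentiable (by simp) p).mfderiv]
  simp only [writtenInExtChartAt, extChartAt_model_space_eq_id, PartialEquiv.refl_coe,
    Function.id_comp, modelWithCornersSelf_coe, Set.range_id, fderivWithin_univ]
  rfl

theorem differentiableAt_comp_extChartAt_symm (f : C^∞⟮𝓘(ℝ, E), M; ℝ⟯) (p : M) :
    DifferentiableAt ℝ (f ∘ (extChartAt 𝓘(ℝ, E) p).symm) (extChartAt 𝓘(ℝ, E) p p) :=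
  (f.contMDiff.contMDiffAt.comp _ ((contMDiffOn_extChartAt_symm p).contMDiffAt
    (extChartAt_target_mem_nhds p))).contDiffAt.differentiableAt (by simp)

end Charts

section ExteriorDerivative

open Filter Topology

variable {E : Type*} [NormedAddCommGroup E] [NormedSpace ℝ E]
  {M : Type*} [TopologicalSpace M] [ChartedSpace E M] [IsManifold 𝓘(ℝ, E) ∞ M]

/-- The component of a form `β` along the constant-coefficient multivector field `c` of the chart
`φ` around `x`, as a function on the image of `φ`. -/
noncomputable def RawForm.coeff (β : RawForm E M) (x : M) (c : ExteriorAlgebra ℝ E) (y : E) : ℝ :=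
  β ((extChartAt 𝓘(ℝ, E) x).symm y)
    (ExteriorAlgebra.map (dChartSymm E M x ((extChartAt 𝓘(ℝ, E) x).symm y)) c)

theorem RawForm.coeff_extChartAt (β : RawForm E M) {x q : M} (hq : q ∈ (chartAt E x).source)
    (c : ExteriorAlgebra ℝ E) : β.coeff x c (extChartAt 𝓘(ℝ, E) x q) =
      β q (ExteriorAlgebra.map (dChartSymm E M x q) c) := by
  rw [RawForm.coeff, extChartAt_symm_extChartAt hq]

theorem RawForm.IsSmooth.contDiffOn_coeff {β : RawForm E M} (hβ : β.IsSmooth) (x : M)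
    (c : ExteriorAlgebra ℝ E) :
    ContDiffOn ℝ ∞ (β.coeff x c) (extChartAt 𝓘(ℝ, E) x).target := by
  rw [← contMDiffOn_iff_contDiffOn]
  exact (hβ x c).comp (contMDiffOn_extChartAt_symm x) fun y hy => by
    simpa using (extChartAt 𝓘(ℝ, E) x).map_target hy

theorem RawForm.IsSmooth.differentiableAt_coeff {β : RawForm E M} (hβ : β.IsSmooth) {x q : M}
    (hq : q ∈ (chartAt E x).source) (c : ExteriorAlgebra ℝ E) :
    DifferentiableAt ℝ (β.coeff x c) (extChartAt 𝓘(ℝ, E) x q) :=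
  ((hβ.contDiffOn_coeff x c).contDiffAt
    (extChartAt_target_mem_nhds_of_mem_source hq)).differentiableAt (by simp)

variable [FiniteDimensional ℝ E]

/-- The basis `e_{i₁} ∧ ⋯ ∧ e_{iₖ}` (`i₁ < ⋯ < iₖ`) of `⋀ E` attached to the basis of `E` in which
the Schouten bracket is expressed. -/
noncomputable def extBasis (E : Type*) [NormedAddCommGroup E] [NormedSpace ℝ E]
    [FiniteDimensional ℝ E] :
    Module.Basis (Finset (Fin (Module.finrank ℝ E))) ℝ (ExteriorAlgebra ℝ E) :=
  (Module.finBasis ℝ E).ExteriorAlgebra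

theorem RawForm.apply_eq_sum_coeff (β : RawForm E M) {x q : M} (hq : q ∈ (chartAt E x).source)
    (z : ExteriorAlgebra ℝ (TangentSpace 𝓘(ℝ, E) q)) :
    β q z = ∑ s, β.coeff x (extBasis E s) (extChartAt 𝓘(ℝ, E) x q) *
      (extBasis E).coord s (ExteriorAlgebra.map (dChart E M x q) z) := by
  conv_lhs => rw [← map_dChartSymm_map_dChart hq z,
    ← (extBasis E).sum_repr (ExteriorAlgebra.map (dChart E M x q) z)]
  simp only [map_sum, map_smul, smul_eq_mul, β.coeff_extChartAt hq, Module.Basis.coord_apply,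
    mul_comm]

theorem RawForm.inChart_eq_sum (β : RawForm E M) (x : M) (j : ℕ) (y : E) :
    β.inChart x j y = ∑ s, β.coeff x (extBasis E s) y •
      toContAlt (altOfDual ((extBasis E).coord s) j) := by
  ext v
  have h : β.inChart x j y v = β ((extChartAt 𝓘(ℝ, E) x).symm y)
      (ExteriorAlgebra.map (dChartSymm E M x ((extChartAt 𝓘(ℝ, E) x).symm y))
        (ExteriorAlgebra.ιMulti ℝ j v)) := by
    rw [ExteriorAlgebra.map_apply_ιMulti]
    rfl
  rw [h, ← (extBasis E).sum_repr (ExteriorAlgebra.ιMulti ℝ j v)]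
  simp only [map_sum, map_smul, smul_eq_mul, ContinuousAlternatingMap.sum_apply,
    ContinuousAlternatingMap.smul_apply]
  exact Finset.sum_congr rfl fun s _ => mul_comm _ _

theorem RawForm.IsSmooth.differentiableAt_inChart {β : RawForm E M} (hβ : β.IsSmooth) {x q : M}
    (hq : q ∈ (chartAt E x).source) (j : ℕ) :
    DifferentiableAt ℝ (β.inChart x j) (extChartAt 𝓘(ℝ, E) x q) := by
  rw [funext (β.inChart_eq_sum x j)]
  exact DifferentiableAt.fun_sum fun s _ => (hβ.differentiableAt_coeff hq _).smul_const _

theorem RawForm.inChart_extChartAt (β : RawForm E M) {x x' q : M}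
    (hq : q ∈ (chartAt E x).source) (hq' : q ∈ (chartAt E x').source) (j : ℕ) :
    β.inChart x j (extChartAt 𝓘(ℝ, E) x q) =
      (β.inChart x' j (extChartAt 𝓘(ℝ, E) x' q)).compContinuousLinearMap
        (tangentCoordChange 𝓘(ℝ, E) x x' q) := by
  have hsymm (v : E) : dChartSymm E M x' q (tangentCoordChange 𝓘(ℝ, E) x x' q v) =
      dChartSymm E M x q v := by
    rw [← dChart_dChartSymm hq hq', dChartSymm_dChart hq']
  rw [RawForm.inChart, RawForm.inChart, extChartAt_symm_extChartAt hq,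
    extChartAt_symm_extChartAt hq']
  ext v
  exact congrArg (altOfDual (β q) j) (funext fun i => (hsymm (v i)).symm)

theorem RawForm.inChart_eventuallyEq (β : RawForm E M) {x x' q : M}
    (hq : q ∈ (chartAt E x).source) (hq' : q ∈ (chartAt E x').source) (j : ℕ) :
    β.inChart x j =ᶠ[𝓝 (extChartAt 𝓘(ℝ, E) x q)] fun y =>
      (β.inChart x' j ((extChartAt 𝓘(ℝ, E) x' ∘ (extChartAt 𝓘(ℝ, E) x).symm) y)
        ).compContinuousLinearMap
        (fderiv ℝ (extChartAt 𝓘(ℝ, E) x' ∘ (extChartAt 𝓘(ℝ, E) x).symm) y) := by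
  refine eventually_nhds_extChartAt hq ?_
  filter_upwards [(chartAt E x).open_source.mem_nhds hq,
    (chartAt E x').open_source.mem_nhds hq'] with p hp hp'
  rw [(hasFDerivAt_transition hp hp').fderiv, Function.comp_apply, extChartAt_symm_extChartAt hp]
  exact β.inChart_extChartAt hp hp' j

theorem extD_apply_ιMulti {β : RawForm E M} (hβ : β.IsSmooth) {x q : M}
    (hq : q ∈ (chartAt E x).source) {j : ℕ} (v : Fin (j + 1) → TangentSpace 𝓘(ℝ, E) q) :
    extD β q (ExteriorAlgebra.ιMulti ℝ (j + 1) v) =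
      extDeriv (β.inChart x j) (extChartAt 𝓘(ℝ, E) x q) (fun i => dChart E M x q (v i)) := by
  have hqq := mem_chart_source E q
  have htransition : (extChartAt 𝓘(ℝ, E) x ∘ (extChartAt 𝓘(ℝ, E) q).symm)
      (extChartAt 𝓘(ℝ, E) q q) = extChartAt 𝓘(ℝ, E) x q := by
    rw [Function.comp_apply, extChartAt_symm_extChartAt hqq]
  have hpullback : extDeriv (β.inChart q j) (extChartAt 𝓘(ℝ, E) q q) =
      (extDeriv (β.inChart x j) (extChartAt 𝓘(ℝ, E) x q)).compContinuousLinearMap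
        (tangentCoordChange 𝓘(ℝ, E) q x q) := by
    rw [(β.inChart_eventuallyEq hqq hq j).extDeriv_eq,
      extDeriv_pullback (r := ∞) (htransition ▸ hβ.differentiableAt_inChart hq j)
        (contDiffAt_transition hqq hq)
        (by rw [minSmoothness_of_isRCLikeNormedField]; exact WithTop.coe_le_coe.2 le_top),
      (hasFDerivAt_transition hqq hq).fderiv, htransition]
  rw [extD, ExteriorAlgebra.liftAlternating_apply_ιMulti]
  change extDeriv (β.inChart q j) (extChartAt 𝓘(ℝ, E) q q) (fun i => dChart E M q q (v i)) = _
  rw [hpullback, dChart_self, dChart_eq_tangentCoordChange hq]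
  rfl

theorem extDeriv_inChart_apply {β : RawForm E M} (hβ : β.IsSmooth) {x q : M}
    (hq : q ∈ (chartAt E x).source) {j : ℕ} (v : Fin (j + 1) → E) :
    extDeriv (β.inChart x j) (extChartAt 𝓘(ℝ, E) x q) v = ∑ s, (extBasis E).coord s
      (contractL (fderiv ℝ (β.coeff x (extBasis E s)) (extChartAt 𝓘(ℝ, E) x q)).toLinearMap
        (ExteriorAlgebra.ιMulti ℝ (j + 1) v)) := by
  have hcoeff (s) := hβ.differentiableAt_coeff hq (extBasis E s)
  rw [extDeriv, funext (β.inChart_eq_sum x j),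
    fderiv_fun_sum fun s _ =>
      (hcoeff s).smul_const (toContAlt (altOfDual ((extBasis E).coord s) j)),
    ContinuousAlternatingMap.alternatizeUncurryFin_apply]
  simp only [← sum_altOfDual_removeNth]
  rw [Finset.sum_comm]
  refine Finset.sum_congr rfl fun i _ => ?_
  rw [sum_apply, ContinuousAlternatingMap.sum_apply, Finset.smul_sum]
  refine Finset.sum_congr rfl fun s _ => ?_
  rw [fderiv_smul_const (hcoeff s), ContinuousLinearMap.smulRight_apply,
    ContinuousAlternatingMap.smul_apply, smul_eq_mul, zsmul_eq_mul]
  push_cast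
  rfl

/-- If `β = ∑ₛ gₛ eˢ` in the chart around `x`, for the dual basis `eˢ` of `⋀ E`, then
`dβ = ∑ₛ dgₛ ∧ eˢ`, and wedging with `dgₛ` is dual to contracting with it. -/
theorem extD_apply {β : RawForm E M} (hβ : β.IsSmooth) {x q : M}
    (hq : q ∈ (chartAt E x).source) (z : ExteriorAlgebra ℝ (TangentSpace 𝓘(ℝ, E) q)) :
    extD β q z = ∑ s, (extBasis E).coord s
      (contractL (fderiv ℝ (β.coeff x (extBasis E s)) (extChartAt 𝓘(ℝ, E) x q)).toLinearMap
        (ExteriorAlgebra.map (dChart E M x q) z)) := by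
  suffices h : extD β q = ∑ s, (extBasis E).coord s ∘ₗ
      CliffordAlgebra.contractLeft
        (fderiv ℝ (β.coeff x (extBasis E s)) (extChartAt 𝓘(ℝ, E) x q)).toLinearMap ∘ₗ
        (ExteriorAlgebra.map (dChart E M x q)).toLinearMap by
    rw [h, LinearMap.sum_apply]
    rfl
  refine ExteriorAlgebra.lhom_ext fun j => AlternatingMap.ext fun v => ?_
  simp only [LinearMap.compAlternatingMap_apply, LinearMap.sum_apply, LinearMap.comp_apply,
    AlgHom.toLinearMap_apply]
  cases j with
  | zero =>
    simp only [ExteriorAlgebra.ιMulti_zero_apply, map_one, CliffordAlgebra.contractLeft_one,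
      map_zero, Finset.sum_const_zero, extD, ExteriorAlgebra.liftAlternating_one]
    rfl
  | succ j =>
    rw [extD_apply_ιMulti hβ hq, extDeriv_inChart_apply hβ hq]
    simp only [ExteriorAlgebra.map_apply_ιMulti]
    rfl

theorem contractL_eq_sum (d : Module.Dual ℝ E) (x : ExteriorAlgebra ℝ E) :
    contractL d x = ∑ i, d (Module.finBasis ℝ E i) •
      contractL ((Module.finBasis ℝ E).coord i) x := by
  have h : d = ∑ i, d (Module.finBasis ℝ E i) • (Module.finBasis ℝ E).coord i := by simp
  conv_lhs => rw [contractL, h]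
  simp only [map_sum, map_smul, LinearMap.sum_apply, LinearMap.smul_apply, contractL]

theorem contMDiff_extD_apply {β : RawForm E M} (hβ : β.IsSmooth) {X : RawMVF E M}
    (hX : X.IsSmooth) : ContMDiff 𝓘(ℝ, E) 𝓘(ℝ, ℝ) ∞ fun p => extD β p (X p) := by
  refine contMDiff_of_locally_contMDiffOn fun x =>
    ⟨(chartAt E x).source, (chartAt E x).open_source, mem_chart_source E x, ?_⟩
  refine ContMDiffOn.congr ?_ fun p hp => extD_apply hβ hp (X p)
  simp only [contractL_eq_sum (_ : E →L[ℝ] ℝ).toLinearMap, map_sum, map_smul, smul_eq_mul]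
  refine contMDiffOn_finsetSum fun s _ => contMDiffOn_finsetSum fun i _ => ContMDiffOn.mul ?_
    (hX x ((extBasis E).coord s ∘ₗ
      CliffordAlgebra.contractLeft ((Module.finBasis ℝ E).coord i)))
  have h := (hβ.contDiffOn_coeff x (extBasis E s)).fderiv_of_isOpen (m := ∞)
    (isOpen_extChartAt_target x) (by simp)
  exact (h.clm_apply contDiffOn_const).contMDiffOn.comp (contMDiffOn_extChartAt (n := ∞))
    fun p hp => (extChartAt 𝓘(ℝ, E) x).map_source (by simpa using hp)

theorem extD_add {β β' : RawForm E M} (hβ : β.IsSmooth) (hβ' : β'.IsSmooth) :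
    extD (β + β') = extD β + extD β' := by
  funext p
  refine LinearMap.ext fun z => ?_
  have hp := mem_chart_source E p
  have hcoeff (s) : (β + β').coeff p (extBasis E s) =
    β.coeff p (extBasis E s) + β'.coeff p (extBasis E s) := rfl
  rw [Pi.add_apply, LinearMap.add_apply, extD_apply ((DForm E M).add_mem hβ hβ') hp,
    extD_apply hβ hp, extD_apply hβ' hp, ← Finset.sum_add_distrib]
  refine Finset.sum_congr rfl fun s _ => ?_
  rw [hcoeff, fderiv_add (hβ.differentiableAt_coeff hp _) (hβ'.differentiableAt_coeff hp _),
    ContinuousLinearMap.toLinearMap_add, contractL, map_add, LinearMap.add_apply, map_add]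
  rfl

theorem extD_smul {β : RawForm E M} (hβ : β.IsSmooth) (f : C^∞⟮𝓘(ℝ, E), M; ℝ⟯) (p : M)
    (z : ExteriorAlgebra ℝ (TangentSpace 𝓘(ℝ, E) p)) :
    extD (fun q => f q • β q) p z = f p * extD β p z + β p (contractL (differential f p) z) := by
  have hp := mem_chart_source E p
  have hsmul : RawForm.IsSmooth (fun q => f q • β q) := fun x c =>
    f.contMDiff.contMDiffOn.mul (hβ x c)
  have hfderiv (s) : fderiv ℝ (RawForm.coeff (fun q => f q • β q) p (extBasis E s))
      (extChartAt 𝓘(ℝ, E) p p) = f p • fderiv ℝ (β.coeff p (extBasis E s))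
        (extChartAt 𝓘(ℝ, E) p p) + β.coeff p (extBasis E s) (extChartAt 𝓘(ℝ, E) p p) •
        fderiv ℝ (f ∘ (extChartAt 𝓘(ℝ, E) p).symm) (extChartAt 𝓘(ℝ, E) p p) := by
    refine (fderiv_mul (differentiableAt_comp_extChartAt_symm f p)
      (hβ.differentiableAt_coeff hp (extBasis E s))).trans ?_
    rw [Function.comp_apply, extChartAt_symm_extChartAt hp]
  rw [extD_apply hsmul hp, extD_apply hβ hp, β.apply_eq_sum_coeff hp, Finset.mul_sum,
    ← Finset.sum_add_distrib]
  refine Finset.sum_congr rfl fun s _ => ?_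
  simp only [hfderiv, contractL, ContinuousLinearMap.toLinearMap_add,
    ContinuousLinearMap.toLinearMap_smul, map_add, map_smul, LinearMap.add_apply,
    LinearMap.smul_apply, smul_eq_mul, differential_eq_fderiv_comp_dChart, contractLeft_map]

end ExteriorDerivative

section Connection

variable {E : Type*} [NormedAddCommGroup E] [NormedSpace ℝ E]
  {M : Type*} [TopologicalSpace M] [ChartedSpace E M]

theorem interior_add (Y Y' : RawMVF E M) (β : RawForm E M) :
    interior (Y + Y') β = interior Y β + interior Y' β :=
  funext fun p => LinearMap.ext fun z => by
    simp only [interior, Pi.add_apply, LinearMap.add_apply, LinearMap.comp_apply,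
      LinearMap.mulLeft_apply, add_mul, map_add]

theorem interior_smul (g : M → ℝ) (Y : RawMVF E M) (β : RawForm E M) :
    interior (fun p => g p • Y p) β = fun p => g p • interior Y β p :=
  funext fun p => LinearMap.ext fun z => by
    simp only [interior, LinearMap.smul_apply, LinearMap.comp_apply, LinearMap.mulLeft_apply,
      smul_mul_assoc, map_smul]

variable [FiniteDimensional ℝ E] [IsManifold 𝓘(ℝ, E) ∞ M]

theorem RawForm.IsSmooth.interior {β : RawForm E M} (hβ : β.IsSmooth) {Y : RawMVF E M}
    (hY : Y.IsSmooth) : (interior Y β).IsSmooth := by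
  intro x c
  have h : ∀ p ∈ (chartAt E x).source,
      HigherConn.interior Y β p (ExteriorAlgebra.map (dChartSymm E M x p) c) =
        ∑ s, (extBasis E).coord s (ExteriorAlgebra.map (dChart E M x p) (Y p)) *
          β p (ExteriorAlgebra.map (dChartSymm E M x p) (extBasis E s * c)) := by
    intro p hp
    change β p (Y p * _) = _
    conv_lhs => rw [← map_dChartSymm_map_dChart hp (Y p),
      ← (extBasis E).sum_repr (ExteriorAlgebra.map (dChart E M x p) (Y p)), ← map_mul]
    simp only [Finset.sum_mul, map_sum, smul_mul_assoc, map_smul, smul_eq_mul,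
      Module.Basis.coord_apply]
  exact (contMDiffOn_finsetSum fun s _ => (hY x _).mul (hβ x _)).congr h

theorem RawForm.IsSmooth.contMDiff_apply {β : RawForm E M} (hβ : β.IsSmooth) {Y : RawMVF E M}
    (hY : Y.IsSmooth) : ContMDiff 𝓘(ℝ, E) 𝓘(ℝ, ℝ) ∞ fun p => β p (Y p) := by
  refine contMDiff_of_locally_contMDiffOn fun x =>
    ⟨(chartAt E x).source, (chartAt E x).open_source, mem_chart_source E x, ?_⟩
  simpa only [map_one, HigherConn.interior, LinearMap.comp_apply, LinearMap.mulLeft_apply,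
    mul_one] using hβ.interior hY x 1

theorem extAlgDeriv_algebraMap {g : E → ℝ} {y : E} (hg : DifferentiableAt ℝ g y) (v : E) :
    extAlgDeriv (fun z => algebraMap ℝ (ExteriorAlgebra ℝ E) (g z)) y v =
      algebraMap ℝ _ (fderiv ℝ g y v) := by
  simp only [extAlgDeriv, Algebra.algebraMap_eq_smul_one, map_smul, smul_eq_mul,
    fderiv_mul_const hg, smul_apply]
  conv_rhs => rw [← (extBasis E).sum_repr 1, Finset.smul_sum]
  refine Finset.sum_congr rfl fun s _ => ?_
  rw [smul_smul, mul_comm]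
  rfl

theorem contractR_eq_sum (x : ExteriorAlgebra ℝ E) (d : Module.Dual ℝ E) :
    contractR x d = ∑ i, d (Module.finBasis ℝ E i) •
      contractR x ((Module.finBasis ℝ E).coord i) := by
  have h : d = ∑ i, d (Module.finBasis ℝ E i) • (Module.finBasis ℝ E).coord i := by simp
  conv_lhs => rw [contractR, h]
  simp only [map_sum, map_smul, contractR]

theorem schouten_funMVF (X : RawMVF E M) (f : C^∞⟮𝓘(ℝ, E), M; ℝ⟯) (p : M) :
    schouten X (funMVF f).1 p = contractR (X p) (differential f p) := by
  have hp := mem_chart_source E p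
  have hX : X.inChart p (extChartAt 𝓘(ℝ, E) p p) = ExteriorAlgebra.map (dChart E M p p) (X p) := by
    rw [RawMVF.inChart, extChartAt_symm_extChartAt hp]
  have hf : (funMVF f).1.inChart p = fun y => algebraMap ℝ (ExteriorAlgebra ℝ E)
      ((f ∘ (extChartAt 𝓘(ℝ, E) p).symm) y) :=
    funext fun y => AlgHom.commutes _ _
  have hschoutenE : schoutenE (X.inChart p) ((funMVF f).1.inChart p) (extChartAt 𝓘(ℝ, E) p p) =
      contractR (ExteriorAlgebra.map (dChart E M p p) (X p)) (fderiv ℝ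
        (f ∘ (extChartAt 𝓘(ℝ, E) p).symm) (extChartAt 𝓘(ℝ, E) p p)).toLinearMap := by
    rw [schoutenE, hX, hf, contractR_eq_sum]
    refine Finset.sum_congr rfl fun i _ => ?_
    rw [extAlgDeriv_algebraMap (differentiableAt_comp_extChartAt_symm f p), contractL,
      CliffordAlgebra.contractLeft_algebraMap, mul_zero, sub_zero,
      Algebra.algebraMap_eq_smul_one, mul_smul_comm, mul_one]
    rfl
  rw [schouten, hschoutenE, contractR, contractRight_map, ← differential_eq_fderiv_comp_dChart,
    map_dChartSymm_map_dChart hp, contractR]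

theorem apply_schouten_mul {k m : ℤ} {X Y : MVF E M} (hX : X ∈ MVF.ofDegree E M k)
    (hY : Y ∈ MVF.ofDegree E M m) (α : RawForm E M) (f : C^∞⟮𝓘(ℝ, E), M; ℝ⟯) (p : M) :
    α p (schouten X.1 (funMVF f).1 p * Y.1 p) = (-1 : ℝ) ^ ((k - 1) * (m + 1)) *
      interior Y.1 α p (contractL (differential f p) (X.1 p)) := by
  rw [schouten_funMVF, contractR_of_mem_gradedPart _ (hX p), smul_mul_assoc,
    mul_comm_of_mem_gradedPart (contractL_mem_gradedPart _ (hX p)) (hY p), smul_smul,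
    ← zpow_add₀ (by norm_num), map_smul, smul_eq_mul,
    show k - 1 + (k - 1) * m = (k - 1) * (m + 1) by ring]
  rfl

namespace HigherConnection

variable (C : HigherConnection E M)

theorem covForm_apply (k l : ℤ) (X : MVF E M) (α : DForm E M) (Y : MVF E M) (p : M) :
    C.covForm k l X α Y p = (-1 : ℝ) ^ ((k - 1) * l) * extD (interior Y.1 α.1) p (X.1 p) -
      α.1 p ((C.nabla X Y).1 p) := by
  have hd : extD (interior X.1 (interior Y.1 α.1)) p 1 = 0 :=
    ExteriorAlgebra.liftAlternating_one _
  have hlieD : lieD k X.1 (interior Y.1 α.1) p 1 =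
      (-1 : ℝ) ^ (k - 1) * extD (interior Y.1 α.1) p (X.1 p) := by
    have hsign : (-1 : ℝ) ^ (k - 1) = -(-1) ^ k := by
      rw [zpow_sub_one₀ (by norm_num), inv_neg_one, mul_neg_one]
    rw [lieD, Pi.sub_apply, LinearMap.sub_apply, hd, zero_sub, hsign, neg_mul]
    simp only [interior, Pi.smul_apply, LinearMap.smul_apply, LinearMap.comp_apply,
      LinearMap.mulLeft_apply, mul_one, smul_eq_mul]
  rw [covForm, hlieD, ← mul_assoc, ← zpow_add₀ (by norm_num),
    show (k - 1) * (l - 1) + (k - 1) = (k - 1) * l by ring]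

theorem covForm_add (k l : ℤ) (X : MVF E M) (α : DForm E M) (Y Y' : MVF E M) :
    C.covForm k l X α (Y + Y') = C.covForm k l X α Y + C.covForm k l X α Y' := by
  funext p
  have hnabla : (C.nabla X (Y + Y')).1 p = (C.nabla X Y).1 p + (C.nabla X Y').1 p := by
    rw [C.add_right]
    rfl
  rw [Pi.add_apply, covForm_apply, covForm_apply, covForm_apply, Submodule.coe_add, interior_add,
    extD_add (RawForm.IsSmooth.interior α.2 Y.2) (RawForm.IsSmooth.interior α.2 Y'.2),
    Pi.add_apply, LinearMap.add_apply, hnabla, map_add]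
  ring

theorem covForm_smul {k l : ℤ} {X Y : MVF E M} (hX : X ∈ MVF.ofDegree E M k)
    (hY : Y ∈ MVF.ofDegree E M (l - k + 1)) (α : DForm E M) (f : C^∞⟮𝓘(ℝ, E), M; ℝ⟯) :
    C.covForm k l X α (f • Y) = fun p => f p * C.covForm k l X α Y p := by
  funext p
  have hinterior : interior (f • Y).1 α.1 = fun q => f q • interior Y.1 α.1 q :=
    interior_smul f Y.1 α.1
  have hsign : (-1 : ℝ) ^ ((k - 1) * (l - k + 1 + 1)) = (-1) ^ ((k - 1) * l) := by
    rw [show (k - 1) * (l - k + 1 + 1) = (k - 1) * l - (k - 1) * (k - 1 - 1) by ring,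
      zpow_sub₀ (by norm_num), (Int.even_mul_pred_self (k - 1)).neg_one_zpow, div_one]
  rw [covForm_apply, covForm_apply, hinterior, extD_smul (RawForm.IsSmooth.interior α.2 Y.2),
    C.leibniz hX, map_add, apply_schouten_mul hX hY, hsign, map_smul, smul_eq_mul]
  ring

theorem contMDiff_covForm (k l : ℤ) (X : MVF E M) (α : DForm E M) (Y : MVF E M) :
    ContMDiff 𝓘(ℝ, E) 𝓘(ℝ, ℝ) ∞ (C.covForm k l X α Y) := by
  rw [funext (C.covForm_apply k l X α Y)]
  exact (contMDiff_const.mul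
    (contMDiff_extD_apply (RawForm.IsSmooth.interior α.2 Y.2) X.2)).sub
      (RawForm.IsSmooth.contMDiff_apply α.2 (C.nabla X Y).2)

end HigherConnection

end Connection

section Cutoff

open Set Filter Topology

theorem contMDiffOn_mul_of_tsupport_subset {E H N : Type*} [NormedAddCommGroup E]
    [NormedSpace ℝ E] [TopologicalSpace H] {I : ModelWithCorners ℝ E H} [TopologicalSpace N]
    [ChartedSpace H N] {n : ℕ∞ω} {χ g : N → ℝ} {s u : Set N} (hχ : ContMDiff I 𝓘(ℝ, ℝ) n χ)
    (hu : IsOpen u) (hχu : tsupport χ ⊆ u) (hg : ContMDiffOn I 𝓘(ℝ, ℝ) n g (s ∩ u)) :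
    ContMDiffOn I 𝓘(ℝ, ℝ) n (fun q => χ q * g q) s := by
  refine contMDiffOn_of_locally_contMDiffOn fun q _ => ?_
  by_cases hq : q ∈ tsupport χ
  · exact ⟨u, hu, hχu hq, hχ.contMDiffOn.mul hg⟩
  · refine ⟨(tsupport χ)ᶜ, (isClosed_tsupport χ).isOpen_compl, hq,
      (contMDiffOn_const (c := (0 : ℝ))).congr fun p hp => ?_⟩
    rw [image_eq_zero_of_notMem_tsupport hp.2, zero_mul]

variable {E : Type*} [NormedAddCommGroup E] [NormedSpace ℝ E] [FiniteDimensional ℝ E]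
  {M : Type*} [TopologicalSpace M] [ChartedSpace E M]

theorem exists_cutoff [T2Space M] [IsManifold 𝓘(ℝ, E) ∞ M] {x q : M}
    (hq : q ∈ (chartAt E x).source) :
    ∃ χ : C^∞⟮𝓘(ℝ, E), M; ℝ⟯, tsupport χ ⊆ (chartAt E x).source ∧ ∀ᶠ p in 𝓝 q, χ p = 1 := by
  obtain ⟨χ, hχ⟩ := (SmoothBumpFunction.nhds_basis_support (I := 𝓘(ℝ, E))
    ((chartAt E x).open_source.mem_nhds hq)).ex_mem
  exact ⟨⟨χ, χ.contMDiff⟩, hχ, χ.eventuallyEq_one⟩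

variable [IsManifold 𝓘(ℝ, E) ∞ M]

/-- The component of `Y` along `a`, in the chart around `x`, cut off by a function `χ` supported in
the domain of this chart and extended by zero. -/
noncomputable def cutoffCoord {x : M} (χ : C^∞⟮𝓘(ℝ, E), M; ℝ⟯)
    (hχ : tsupport χ ⊆ (chartAt E x).source) (a : Module.Dual ℝ (ExteriorAlgebra ℝ E))
    (Y : MVF E M) : C^∞⟮𝓘(ℝ, E), M; ℝ⟯ where
  val q := χ q * a (ExteriorAlgebra.map (dChart E M x q) (Y.1 q))
  property := contMDiffOn_univ.1 <| contMDiffOn_mul_of_tsupport_subset χ.contMDiff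
    (chartAt E x).open_source hχ ((Y.2 x a).mono inter_subset_right)

/-- The constant-coefficient multivector field `c` of the chart around `x`, cut off by a function
`χ` supported in the domain of this chart and extended by zero. -/
noncomputable def cutoffMVF {x : M} (χ : C^∞⟮𝓘(ℝ, E), M; ℝ⟯)
    (hχ : tsupport χ ⊆ (chartAt E x).source) : ExteriorAlgebra ℝ E →ₗ[ℝ] MVF E M where
  toFun c := ⟨fun q => χ q • ExteriorAlgebra.map (dChartSymm E M x q) c, fun x' a => by
    simp only [map_smul, smul_eq_mul]
    refine contMDiffOn_mul_of_tsupport_subset χ.contMDiff (chartAt E x).open_source hχ ?_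
    rw [inter_comm]
    refine (contMDiffOn_exteriorAlgebra_map (contMDiffOn_tangentCoordChange x x') a c).congr
      fun q hq => ?_
    rw [map_dChart_map_dChartSymm hq.1 hq.2]⟩
  map_add' c d := Subtype.ext <| funext fun q => by
    simp only [map_add, smul_add, Submodule.coe_add, Pi.add_apply]
  map_smul' r c := Subtype.ext <| funext fun q => by
    simp only [map_smul, smul_comm (χ q) r, RingHom.id_apply, Submodule.coe_smul, Pi.smul_apply]

variable {x : M} {χ : C^∞⟮𝓘(ℝ, E), M; ℝ⟯} (hχ : tsupport χ ⊆ (chartAt E x).source)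

theorem cutoffMVF_apply_of_eq_one {q : M} (hq : χ q = 1) (c : ExteriorAlgebra ℝ E) :
    (cutoffMVF χ hχ c).1 q = ExteriorAlgebra.map (dChartSymm E M x q) c := by
  change χ q • _ = _
  rw [hq, one_smul]

theorem cutoffMVF_mem_ofDegree {k : ℤ} {c : ExteriorAlgebra ℝ E} (hc : c ∈ gradedPart E k) :
    cutoffMVF χ hχ c ∈ MVF.ofDegree E M k :=
  fun _ => Submodule.smul_mem _ _ (map_mem_gradedPart _ hc)

theorem smul_smul_eq_sum_cutoffCoord_smul_cutoffMVF (Y : MVF E M) :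
    χ • χ • Y = ∑ s, cutoffCoord χ hχ ((extBasis E).coord s) Y • cutoffMVF χ hχ (extBasis E s) := by
  refine Subtype.ext (funext fun q => ?_)
  rw [AddSubmonoidClass.coe_finsetSum, Finset.sum_apply]
  change χ q • χ q • Y.1 q = ∑ s, (χ q * _) • (χ q • _)
  by_cases hq : q ∈ tsupport χ
  · conv_lhs => rw [← map_dChartSymm_map_dChart (hχ hq) (Y.1 q),
      ← (extBasis E).sum_repr (ExteriorAlgebra.map (dChart E M x q) (Y.1 q))]
    simp only [map_sum, map_smul, Finset.smul_sum, mul_smul, Module.Basis.coord_apply,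
      smul_comm (χ q) ((extBasis E).repr _ _)]
  · simp only [image_eq_zero_of_notMem_tsupport hq, zero_smul, zero_mul, Finset.sum_const_zero]

theorem exists_mem_ofDegree_apply_eq [T2Space M] {k : ℤ} {p : M}
    {v : ExteriorAlgebra ℝ (TangentSpace 𝓘(ℝ, E) p)}
    (hv : v ∈ gradedPart (TangentSpace 𝓘(ℝ, E) p) k) : ∃ Y ∈ MVF.ofDegree E M k, Y.1 p = v := by
  have hp := mem_chart_source E p
  obtain ⟨χ, hχ, hχ1⟩ := exists_cutoff hp
  refine ⟨_, cutoffMVF_mem_ofDegree hχ (map_mem_gradedPart (dChart E M p p) hv), ?_⟩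
  rw [cutoffMVF_apply_of_eq_one hχ hχ1.self_of_nhds, map_dChartSymm_map_dChart hp]

end Cutoff

section Tensoriality

variable {E : Type*} [NormedAddCommGroup E] [NormedSpace ℝ E]
  {M : Type*} [TopologicalSpace M] [ChartedSpace E M] [IsManifold 𝓘(ℝ, E) ∞ M]

instance : IsScalarTower ℝ C^∞⟮𝓘(ℝ, E), M; ℝ⟯ (MVF E M) :=
  ⟨fun r f Y => Subtype.ext (funext fun p => smul_assoc r (f p) (Y.1 p))⟩

variable (E M) in
/-- The `k`-vector fields, as a submodule of `𝒜(M)` over `C^∞(M)`. -/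
def MVF.homogeneous (k : ℤ) : Submodule C^∞⟮𝓘(ℝ, E), M; ℝ⟯ (MVF E M) where
  carrier := MVF.ofDegree E M k
  zero_mem' := zero_mem _
  add_mem' := add_mem
  smul_mem' f _ hY p := (gradedPart _ k).smul_mem (f p) (hY p)

variable (E M) in
/-- The projection `𝒜(M) → Aᵏ(M)`. -/
noncomputable def MVF.homogeneousProj (k : ℤ) :
    MVF E M →ₗ[C^∞⟮𝓘(ℝ, E), M; ℝ⟯] MVF.homogeneous E M k where
  toFun Y := ⟨⟨fun p => gradedProj _ k (Y.1 p), fun x a => by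
    simpa only [map_gradedProj, LinearMap.comp_apply] using Y.2 x (a ∘ₗ gradedProj E k)⟩,
      fun p => gradedProj_mem k (Y.1 p)⟩
  map_add' Y Y' := Subtype.ext <| Subtype.ext <| funext fun p => map_add _ (Y.1 p) (Y'.1 p)
  map_smul' f Y := Subtype.ext <| Subtype.ext <| funext fun p => map_smul _ (f p) (Y.1 p)

theorem MVF.homogeneousProj_coe {k : ℤ} (Y : MVF.homogeneous E M k) :
    MVF.homogeneousProj E M k Y = Y :=
  Subtype.ext <| Subtype.ext <| funext fun p => gradedProj_of_mem (Y.2 p)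

theorem MVF.homogeneousProj_of_mem_ne {j k : ℤ} {Y : MVF E M} (hY : Y ∈ MVF.ofDegree E M j)
    (h : j ≠ k) : MVF.homogeneousProj E M k Y = 0 :=
  Subtype.ext <| Subtype.ext <| funext fun p => gradedProj_of_mem_ne (hY p) h

variable [FiniteDimensional ℝ E] [T2Space M]

section Locality

variable (T : MVF E M →ₗ[C^∞⟮𝓘(ℝ, E), M; ℝ⟯] C^∞⟮𝓘(ℝ, E), M; ℝ⟯)

theorem linearMap_apply_eq_zero {Y : MVF E M} {p : M} (hY : Y.1 p = 0) : T Y p = 0 := by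
  obtain ⟨χ, hχ, hχ1⟩ := exists_cutoff (mem_chart_source E p)
  let ev := ContMDiffMap.evalRingHom (n := ∞) (I := 𝓘(ℝ, E)) (I' := 𝓘(ℝ, ℝ)) (R := ℝ) p
  have hcoord (a : Module.Dual ℝ (ExteriorAlgebra ℝ E)) : ev (cutoffCoord χ hχ a Y) = 0 := by
    change χ p * a (ExteriorAlgebra.map (dChart E M p p) (Y.1 p)) = 0
    rw [hY, map_zero, map_zero, mul_zero]
  have hχp : ev χ = 1 := hχ1.self_of_nhds
  calc ev (T Y) = ev (T (χ • χ • Y)) := by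
        simp only [map_smul, smul_eq_mul, map_mul, hχp, one_mul]
    _ = ∑ s, ev (cutoffCoord χ hχ ((extBasis E).coord s) Y) *
          ev (T (cutoffMVF χ hχ (extBasis E s))) := by
        rw [smul_smul_eq_sum_cutoffCoord_smul_cutoffMVF hχ]
        simp only [map_sum, map_smul, smul_eq_mul, map_mul]
    _ = 0 := by simp only [hcoord, zero_mul, Finset.sum_const_zero]

theorem linearMap_apply_congr {Y Y' : MVF E M} {p : M} (h : Y.1 p = Y'.1 p) : T Y p = T Y' p := by
  have hsub : T (Y - Y') p = 0 := linearMap_apply_eq_zero T (sub_eq_zero.2 h)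
  rw [map_sub] at hsub
  exact sub_eq_zero.1 hsub

theorem exists_dForm_of_linearMap : ∃ η : DForm E M, ∀ Y : MVF E M, ∀ p, η.1 p (Y.1 p) = T Y p := by
  choose χ hχ hχ1 using fun p : M => exists_cutoff (mem_chart_source E p)
  let η : RawForm E M := fun p => LinearMap.proj p ∘ₗ ContMDiffMap.coeFnLinearMap ∘ₗ
    T.restrictScalars ℝ ∘ₗ cutoffMVF (χ p) (hχ p) ∘ₗ
      (ExteriorAlgebra.map (dChart E M p p)).toLinearMap
  have hη (Y : MVF E M) (p : M) : η p (Y.1 p) = T Y p := linearMap_apply_congr T <| by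
    rw [LinearMap.comp_apply, AlgHom.toLinearMap_apply,
      cutoffMVF_apply_of_eq_one (hχ p) (hχ1 p).self_of_nhds,
      map_dChartSymm_map_dChart (mem_chart_source E p)]
  refine ⟨⟨η, fun x c q hq => ?_⟩, hη⟩
  obtain ⟨ψ, hψ, hψ1⟩ := exists_cutoff hq
  refine (((T (cutoffMVF ψ hψ c)).contMDiff q).congr_of_eventuallyEq ?_).contMDiffWithinAt
  filter_upwards [hψ1] with p hp
  rw [← hη, cutoffMVF_apply_of_eq_one hψ hp]

end Locality

theorem DForm.ext_of_ofDegree {k : ℤ} {η η' : DForm E M} (hη : η ∈ DForm.ofDegree E M k)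
    (hη' : η' ∈ DForm.ofDegree E M k)
    (h : ∀ Y ∈ MVF.ofDegree E M k, ∀ p, η.1 p (Y.1 p) = η'.1 p (Y.1 p)) : η = η' := by
  refine Subtype.ext <| funext fun p => linearMap_ext_of_gradedPart fun j v hv => ?_
  obtain rfl | hj := eq_or_ne j k
  · obtain ⟨Y, hY, rfl⟩ := exists_mem_ofDegree_apply_eq hv
    exact h Y hY p
  · rw [hη j hj p v hv, hη' j hj p v hv]

theorem existsUnique_dForm_of_linearMap {k : ℤ}
    (T : MVF.homogeneous E M k →ₗ[C^∞⟮𝓘(ℝ, E), M; ℝ⟯] C^∞⟮𝓘(ℝ, E), M; ℝ⟯) :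
    ∃! η : DForm E M, η ∈ DForm.ofDegree E M k ∧
      ∀ (Y : MVF.homogeneous E M k) (p : M), η.1 p (Y.1.1 p) = T Y p := by
  obtain ⟨η, hη⟩ := exists_dForm_of_linearMap (T ∘ₗ MVF.homogeneousProj E M k)
  have hηT (Y : MVF.homogeneous E M k) (p : M) : η.1 p (Y.1.1 p) = T Y p := by
    rw [hη, LinearMap.comp_apply, MVF.homogeneousProj_coe]
  have hηk : η ∈ DForm.ofDegree E M k := fun j hj p v hv => by
    obtain ⟨Y, hY, rfl⟩ := exists_mem_ofDegree_apply_eq hv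
    rw [hη, LinearMap.comp_apply, MVF.homogeneousProj_of_mem_ne hY hj, map_zero]
    rfl
  exact ⟨η, ⟨hηk, hηT⟩, fun η' ⟨hη'k, hη'T⟩ => DForm.ext_of_ofDegree hη'k hηk fun Y hY p =>
    (hη'T ⟨Y, hY⟩ p).trans (hηT ⟨Y, hY⟩ p).symm⟩

/-- The expression `(∇_X α)(Y)`, as a `C^∞(M)`-linear map in the `(l - k + 1)`-vector field `Y`. -/
noncomputable def HigherConnection.covFormLinearMap (C : HigherConnection E M) {k l : ℤ}
    {X : MVF E M} (hX : X ∈ MVF.ofDegree E M k) (α : DForm E M) :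
    MVF.homogeneous E M (l - k + 1) →ₗ[C^∞⟮𝓘(ℝ, E), M; ℝ⟯] C^∞⟮𝓘(ℝ, E), M; ℝ⟯ where
  toFun Y := ⟨C.covForm k l X α Y, C.contMDiff_covForm k l X α Y⟩
  map_add' Y Y' := Subtype.ext (C.covForm_add k l X α Y Y')
  map_smul' f Y := Subtype.ext (C.covForm_smul hX Y.2 α f)

end Tensoriality

end HigherConn

theorem mainTheorem6_general
    {E : Type*} [NormedAddCommGroup E] [NormedSpace ℝ E] [FiniteDimensional ℝ E]
    {M : Type*} [TopologicalSpace M] [ChartedSpace E M] [IsManifold 𝓘(ℝ, E) ∞ M] [T2Space M]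
    (C : HigherConn.HigherConnection E M) {k l : ℤ} {X : HigherConn.MVF E M}
    (hX : X ∈ HigherConn.MVF.ofDegree E M k) (α : HigherConn.DForm E M) :
    (∀ Y Y' : HigherConn.MVF E M,
      C.covForm k l X α (Y + Y') = C.covForm k l X α Y + C.covForm k l X α Y') ∧
    (∀ (f : C^∞⟮𝓘(ℝ, E), M; ℝ⟯), ∀ Y ∈ HigherConn.MVF.ofDegree E M (l - k + 1),
      C.covForm k l X α (f • Y) = fun p => f p * C.covForm k l X α Y p) ∧
    (∃! η : HigherConn.DForm E M, η ∈ HigherConn.DForm.ofDegree E M (l - k + 1) ∧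
      ∀ Y ∈ HigherConn.MVF.ofDegree E M (l - k + 1), ∀ p : M,
        η.1 p (Y.1 p) = C.covForm k l X α Y p) := by
  refine ⟨C.covForm_add k l X α, fun f Y hY => C.covForm_smul hX hY α f, ?_⟩
  obtain ⟨η, ⟨hη, hηY⟩, hunique⟩ :=
    HigherConn.existsUnique_dForm_of_linearMap (C.covFormLinearMap (l := l) hX α)
  exact ⟨η, ⟨hη, fun Y hY => hηY ⟨Y, hY⟩⟩,
    fun η' ⟨hη', hη'Y⟩ => hunique η' ⟨hη', fun Y => hη'Y Y.1 Y.2⟩⟩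

theorem mainTheorem6
    {E : Type*} [NormedAddCommGroup E] [NormedSpace ℝ E] [FiniteDimensional ℝ E]
    {M : Type*} [TopologicalSpace M] [ChartedSpace E M] [IsManifold 𝓘(ℝ, E) ∞ M]
    [T2Space M] [SecondCountableTopology M]
    (C : HigherConn.HigherConnection E M) (k l : ℤ) (hk : 0 < k)
    (X : HigherConn.MVF E M) (hX : X ∈ HigherConn.MVF.ofDegree E M k)
    (α : HigherConn.DForm E M) (hα : α ∈ HigherConn.DForm.ofDegree E M l) :
    (∀ Y ∈ HigherConn.MVF.ofDegree E M (l - k + 1),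
      ∀ Y' ∈ HigherConn.MVF.ofDegree E M (l - k + 1),
        C.covForm k l X α (Y + Y') = C.covForm k l X α Y + C.covForm k l X α Y') ∧
    (∀ (f : C^∞⟮𝓘(ℝ, E), M; ℝ⟯), ∀ Y ∈ HigherConn.MVF.ofDegree E M (l - k + 1),
        C.covForm k l X α (f • Y) = fun p => f p * C.covForm k l X α Y p) ∧
    (∃! η : HigherConn.DForm E M, η ∈ HigherConn.DForm.ofDegree E M (l - k + 1) ∧
      ∀ Y ∈ HigherConn.MVF.ofDegree E M (l - k + 1), ∀ p : M,
        η.1 p (Y.1 p) = C.covForm k l X α Y p) :=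
  let ⟨hadd, h⟩ := mainTheorem6_general C hX α
  ⟨fun Y _ Y' _ => hadd Y Y', h⟩
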